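/- Let $K$ be a field of any characteristic, let $X=\{x_1<x_2<x_3<\cdots\}$ be a countably infinite set of variables ordered like the positive integers, and let $K\langle X\rangle$ be the free unital associative $K$-algebra on $X$, with commutator $[f,g]=fg-gf$. Order the words in $X$ by deg-lex: first by length, then lexicographically from left to right with $x_1<x_2<\cdots$; the leading word $\mathrm{lt}(f)$ of $f\neq0$ is the greatest word occurring in $f$ with nonzero coefficient. A subset $G$ of a two-sided ideal $I$ is a Gröbner basis of $I$ if for every nonzero $f\in I$ there is a nonzero $g\in G$ such that $\mathrm{lt}(g)$ is a (contiguous) subword of $\mathrm{lt}(f)$. If $S$ is a semigroup of endomorphisms of $K\langle X\rangle$ containing the identity and $I$ is a two-sided ideal with $\varphi(I)\subseteq I$ for all $\varphi\in S$, then a subset $G\subseteq I$ is a Gröbner $S$-basis of $I$ if $S(G)=\{\varphi(g)\mid \varphi\in S,\ g\in G\}$ is a Gröbner basis of $I$. Let $L$ be the Lie subalgebra of $K\langle X\rangle$ generated by $X$ (the free Lie algebra on $X$), let $\gamma_3(L)=[L,L,L]$ be the third member of its lower central series, and let $I$ be the two-sided ideal of $K\langle X\rangle$ generated by $\gamma_3(L)$.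 Let $S$ be the semigroup of all endomorphisms of the algebra $K\langle X\rangle$ that map $X$ to $X$ and preserve the order on $X$ (if $x<y$ in $X$, then $\varphi(x)<\varphi(y)$). **Theorem.** The ideal $I$ is invariant under $S$, and the five commutators $$[[x_2,x_1],x_1],\quad [x_2,[x_2,x_1]],\quad [x_3,[x_2,x_1]],\quad [[x_3,x_1],x_2],\quad [[x_3,x_2],[x_3,x_1]]$$ form a Gröbner $S$-basis of $I$ with respect to the deg-lex order. Moreover, there is an isomorphism of $K$-algebras from $K\langle X\rangle/I$ onto the universal enveloping algebra $U(F(\mathfrak N_2))$ of the free nilpotent Lie algebra of class $2$ on $X$ (the quotient of the free Lie algebra on $X$ by the third member of its lower central series) that sends the class of each $x\in X$ to the image in $U(F(\mathfrak N_2))$ of the corresponding free generator of $F(\mathfrak N_2)$. -/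

import Mathlib

attribute [local instance 100] LieRing.ofAssociativeRing

namespace GroebnerS

universe u v

section Groebner

variable {K : Type u} [Field K] {X : Type v}

/-- The finite set of words (monomials) that occur with nonzero coefficient in `f`. -/
noncomputable def words (f : FreeAlgebra K X) : Finset (FreeMonoid X) :=
  (FreeAlgebra.equivMonoidAlgebraFreeMonoid f).coeff.support

/-- `w = lt(f)`: the word `w` occurs in `f` and is greater, for the strict order `r` on words,
than every other word that occurs in `f`. No word is the leading word of `0`. -/
def IsLeadingWord (r : FreeMonoid X → FreeMonoid X → Prop)
    (f : FreeAlgebra K X) (w : FreeMonoid X) : Prop :=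
  w ∈ words f ∧ ∀ v ∈ words f, v ≠ w → r v w

/-- `u` is a (contiguous) subword of `w`. -/
def IsSubword (u w : FreeMonoid X) : Prop :=
  ∃ a b : FreeMonoid X, w = a * u * b

/-- `G` is a Gröbner basis of the two-sided ideal `I` for the term-ordering on words whose strict
part is `r`: `G ⊆ I` and the leading word of every nonzero element of `I` has a subword that is the
leading word of an element of `G`. -/
def IsGroebnerBasis (r : FreeMonoid X → FreeMonoid X → Prop)
    (G : Set (FreeAlgebra K X)) (I : TwoSidedIdeal (FreeAlgebra K X)) : Prop :=
  (∀ g ∈ G, g ∈ I) ∧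
    ∀ f ∈ I, f ≠ 0 → ∃ g ∈ G, ∃ u w : FreeMonoid X,
      IsLeadingWord r g u ∧ IsLeadingWord r f w ∧ IsSubword u w

/-- The set `S(B)` of all images of elements of `B` under the endomorphisms in `S`. -/
def orbit (S : Submonoid (FreeAlgebra K X →ₐ[K] FreeAlgebra K X)) (B : Set (FreeAlgebra K X)) :
    Set (FreeAlgebra K X) :=
  {f | ∃ φ ∈ S, ∃ g ∈ B, φ g = f}

/-- `I` is an `S`-ideal: it is mapped into itself by all endomorphisms in `S`. -/
def IsSIdeal (S : Submonoid (FreeAlgebra K X →ₐ[K] FreeAlgebra K X))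
    (I : TwoSidedIdeal (FreeAlgebra K X)) : Prop :=
  ∀ φ ∈ S, ∀ f ∈ I, φ f ∈ I

/-- `G` is a Gröbner `S`-basis of `I`: `I` is an `S`-ideal, `G` is a subset of `I`, and `S(G)` is a
Gröbner basis of `I`. -/
def IsGroebnerSBasis (r : FreeMonoid X → FreeMonoid X → Prop)
    (S : Submonoid (FreeAlgebra K X →ₐ[K] FreeAlgebra K X))
    (G : Set (FreeAlgebra K X)) (I : TwoSidedIdeal (FreeAlgebra K X)) : Prop :=
  IsSIdeal S I ∧ (∀ g ∈ G, g ∈ I) ∧ IsGroebnerBasis r (orbit S G) I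

/-- The strict deg-lex order on words: first by length, then lexicographically from left to right,
letters being compared in `X`. -/
def WordDegLex [LinearOrder X] (u w : FreeMonoid X) : Prop :=
  List.Shortlex (· < ·) u.toList w.toList

end Groebner

section Concrete

variable (K : Type u) [Field K] (X : Type v)

/-- The semigroup of all endomorphisms of `K⟨X⟩` that send `X` to `X` and preserve the order
(`x < y` implies `φ x < φ y`). -/
def orderEnd [LinearOrder X] : Submonoid (FreeAlgebra K X →ₐ[K] FreeAlgebra K X) where
  carrier := {φ | ∃ s : X → X, StrictMono s ∧
    ∀ y, φ (FreeAlgebra.ι K y) = FreeAlgebra.ι K (s y)}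
  one_mem' := ⟨id, strictMono_id, fun _ => rfl⟩
  mul_mem' := by
    rintro φ ψ ⟨s, hs, hφ⟩ ⟨t, ht, hψ⟩
    exact ⟨s ∘ t, hs.comp ht, fun y => by simp [AlgHom.mul_apply, hφ, hψ]⟩

/-- `L = L(X)`: the Lie subalgebra of `K⟨X⟩`, with the commutator as bracket, generated by `X`. -/
noncomputable def lieL : LieSubalgebra K (FreeAlgebra K X) :=
  LieSubalgebra.lieSpan K (FreeAlgebra K X) (Set.range (FreeAlgebra.ι K))

/-- The two-sided ideal of `K⟨X⟩` generated by `γ_{c+1}(L) = [L, …, L]` (`c + 1` factors), the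
member with index `c` of the lower central series of `L` when `L` itself gets the index `0`. -/
noncomputable def gammaIdeal (c : ℕ) : TwoSidedIdeal (FreeAlgebra K X) :=
  TwoSidedIdeal.span
    {f | ∃ l : lieL K X, l ∈ LieModule.lowerCentralSeries K (lieL K X) (lieL K X) c ∧
      (l : FreeAlgebra K X) = f}

/-- `F(𝔑_c)`: the free nilpotent Lie algebra of class `c` on `X`, i.e. the quotient of the free Lie
algebra on `X` by the `(c+1)`-st member of its lower central series. -/
abbrev FreeNilpotent (c : ℕ) : Type (max u v) :=
  FreeLieAlgebra K X ⧸
    LieModule.lowerCentralSeries K (FreeLieAlgebra K X) (FreeLieAlgebra K X) c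

variable {X} in
/-- The free generator of `F(𝔑_c)` that corresponds to `y ∈ X`. -/
noncomputable def FreeNilpotent.of (c : ℕ) (y : X) : FreeNilpotent K X c :=
  LieSubmodule.Quotient.mk (FreeLieAlgebra.of K y)

/-- The universal enveloping algebra `U(F(𝔑_c))`. -/
abbrev UFreeNilpotent (c : ℕ) : Type (max u v) :=
  UniversalEnvelopingAlgebra K (FreeNilpotent K X c)

end Concrete

/-- The set of the five commutators `[[x₂,x₁],x₁]`, `[x₂,[x₂,x₁]]`, `[x₃,[x₂,x₁]]`,
`[[x₃,x₁],x₂]`, `[[x₃,x₂],[x₃,x₁]]`, where `⁅f, g⁆ = f * g - g * f`. -/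
def fiveCommutators {A : Type*} [Ring A] (x₁ x₂ x₃ : A) : Set A :=
  {⁅⁅x₂, x₁⁆, x₁⁆, ⁅x₂, ⁅x₂, x₁⁆⁆, ⁅x₃, ⁅x₂, x₁⁆⁆, ⁅⁅x₃, x₁⁆, x₂⁆, ⁅⁅x₃, x₂⁆, ⁅x₃, x₁⁆⁆}

end GroebnerS

namespace GroebnerS

universe u v

/-! ### The ideal `I`: homomorphisms that kill it, and its invariance under `S` -/

section LowerCentral

variable {K : Type u} [Field K] {X : Type v}

/-! Modulo `I` the commutators of variables are central, and a homomorphism that makes them central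
kills `I` (`eq_zero_of_mem_gammaIdeal`).

The order-preserving images of the five commutators lie in `I` and have leading words `baa`, `bba`,
`cba`, `cab`, `cbca` with `a < b < c`. A word containing none of these factors uniquely enough to be
read as an increasing product of letters and two-letter commutators, that is, as the leading word of
a PBW product (`exists_obstruction_or_standard`). It remains to see that such a word never leads an
element of `I`, which needs independence of the PBW products modulo `I`.

Independence comes from a representation on polynomials in variables indexed by `X × X`: the letter
`c` acts as multiplication by the variable `(c, c)` plus a derivation, chosen so that the commutator
of `c` and `a < c` acts as multiplication by the variable `(c, a)`. Hence `I` acts by zero, while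
applying an increasing PBW product to `1` gives its monomial (`symbol_pbwElement`). An element of
`I` led by a PBW word would make one such monomial a combination of monomials of smaller words
(`symbol_mem_standardLowerSpan`), but distinct increasing products have distinct monomials.

The isomorphism with the enveloping algebra is independent of this: universal properties give maps
in both directions that are inverse on generators. -/

theorem mem_lowerCentralSeries_succ_induction {L : Type*} [LieRing L] [LieAlgebra K L]
    (n : ℕ) (V : Submodule K L)
    (h : ∀ l m : L, m ∈ LieModule.lowerCentralSeries K L L n → ⁅l, m⁆ ∈ V) {l : L}
    (hl : l ∈ LieModule.lowerCentralSeries K L L (n + 1)) : l ∈ V := by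
  rw [LieModule.lowerCentralSeries_succ, ← LieSubmodule.mem_toSubmodule,
    LieSubmodule.lieIdeal_oper_eq_linear_span'] at hl
  refine Submodule.span_le.2 ?_ hl
  rintro _ ⟨x, -, m, hm, rfl⟩
  exact h x m hm

theorem map_commutator {A B : Type*} [Ring A] [Ring B] [Algebra K A] [Algebra K B]
    (π : A →ₐ[K] B) (f g : A) : π ⁅f, g⁆ = ⁅π f, π g⁆ := by
  simp [LieRing.of_associative_ring_bracket]

variable {B : Type*} [Ring B] [Algebra K B] (π : FreeAlgebra K X →ₐ[K] B)

theorem lie_eq_zero_of_mem_centralizer {z : B}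
    (hz : z ∈ Subalgebra.centralizer K (Set.range π)) (f : FreeAlgebra K X) : ⁅π f, z⁆ = 0 := by
  rw [LieRing.of_associative_ring_bracket, sub_eq_zero]
  exact Subalgebra.mem_centralizer_iff K |>.1 hz _ ⟨f, rfl⟩

theorem mem_centralizer_range {z : B} (h : ∀ k, ⁅π (FreeAlgebra.ι K k), z⁆ = 0) :
    z ∈ Subalgebra.centralizer K (Set.range π) := by
  rw [Subalgebra.mem_centralizer_iff]
  rintro _ ⟨f, rfl⟩
  change Commute (π f) z
  induction f using FreeAlgebra.induction with
  | grade0 r => rw [AlgHom.commutes]; exact Algebra.commutes r z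
  | grade1 k => exact sub_eq_zero.1 (h k)
  | mul f g hf hg => rw [map_mul]; exact hf.mul_left hg
  | add f g hf hg => rw [map_add]; exact hf.add_left hg

variable (h : ∀ i j k, ⁅π (FreeAlgebra.ι K k), ⁅π (FreeAlgebra.ι K i), π (FreeAlgebra.ι K j)⁆⁆ = 0)

include h

/-- Induction on `m`; for `m = ⁅x, y⁆` the Leibniz rule leaves brackets with the images of `⁅i, x⁆`
and `⁅i, y⁆`, which are central by induction, so the result is even zero. -/
theorem lie_generator_mem_centralizer (i : X) {m : FreeAlgebra K X} (hm : m ∈ lieL K X) :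
    ⁅π (FreeAlgebra.ι K i), π m⁆ ∈ Subalgebra.centralizer K (Set.range π) := by
  induction hm using LieSubalgebra.lieSpan_induction with
  | mem x hx =>
    obtain ⟨j, rfl⟩ := hx
    exact mem_centralizer_range π (h i j)
  | zero => simp
  | add x y _ _ hx hy => rw [map_add, lie_add]; exact add_mem hx hy
  | smul a x _ hx => 
    rw [map_smul, LieRing.of_associative_ring_bracket, mul_smul_comm, smul_mul_assoc, ← smul_sub]
    exact Subalgebra.smul_mem _ hx a
  | lie x y _ _ hx hy =>
    rw [map_commutator, leibniz_lie, ← lie_skew, lie_eq_zero_of_mem_centralizer π hx,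
      lie_eq_zero_of_mem_centralizer π hy]
    simp

theorem lie_mem_centralizer {l m : FreeAlgebra K X} (hl : l ∈ lieL K X) (hm : m ∈ lieL K X) :
    ⁅π l, π m⁆ ∈ Subalgebra.centralizer K (Set.range π) := by
  induction hl using LieSubalgebra.lieSpan_induction with
  | mem x hx =>
    obtain ⟨j, rfl⟩ := hx
    exact lie_generator_mem_centralizer π h j hm
  | zero => simp
  | add x y _ _ hx hy => rw [map_add, add_lie]; exact add_mem hx hy
  | smul a x _ hx => 
    rw [map_smul, LieRing.of_associative_ring_bracket, mul_smul_comm, smul_mul_assoc, ← smul_sub]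
    exact Subalgebra.smul_mem _ hx a
  | lie x y _ _ hx hy =>
    rw [map_commutator, lie_lie, lie_eq_zero_of_mem_centralizer π hx,
      lie_eq_zero_of_mem_centralizer π hy]
    simp

/-- An algebra homomorphism under which the commutators of variables become central kills the
ideal generated by `γ₃(L)`. -/
theorem eq_zero_of_mem_gammaIdeal {f : FreeAlgebra K X} (hf : f ∈ gammaIdeal K X 2) :
    π f = 0 := by
  have key : gammaIdeal K X 2 ≤ TwoSidedIdeal.ker (π : FreeAlgebra K X →+* B) := by
    rw [gammaIdeal, TwoSidedIdeal.span_le]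
    rintro _ ⟨l, hl, rfl⟩
    let ρ : lieL K X →ₗ[K] B := π.toLinearMap ∘ₗ (lieL K X).toSubmodule.subtype
    -- Index `1` is `γ₂(L)`: it goes into the centralizer of the image, so one further bracket gives
    -- zero.
    have h₁ : LieModule.lowerCentralSeries K (lieL K X) (lieL K X) 1 ≤
        (Subalgebra.toSubmodule (Subalgebra.centralizer K (Set.range π))).comap ρ := fun m hm =>
      mem_lowerCentralSeries_succ_induction 0 _ (fun a b _ => by
        change π ⁅(a : FreeAlgebra K X), (b : FreeAlgebra K X)⁆ ∈
          Subalgebra.centralizer K (Set.range π)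
        rw [map_commutator]
        exact lie_mem_centralizer π h a.2 b.2) hm
    have h₂ : l ∈ LinearMap.ker ρ :=
      mem_lowerCentralSeries_succ_induction 1 _ (fun a b hb => by
        change π ⁅(a : FreeAlgebra K X), (b : FreeAlgebra K X)⁆ = 0
        rw [map_commutator]
        exact lie_eq_zero_of_mem_centralizer π (h₁ hb) _) hl
    exact (TwoSidedIdeal.mem_ker _).2 h₂
  exact (TwoSidedIdeal.mem_ker _).1 (key hf)

omit h

theorem lie_lie_mem_gammaIdeal {a b c : FreeAlgebra K X} (ha : a ∈ lieL K X) (hb : b ∈ lieL K X)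
    (hc : c ∈ lieL K X) : ⁅a, ⁅b, c⁆⁆ ∈ gammaIdeal K X 2 := by
  refine TwoSidedIdeal.subset_span
    ⟨⁅(⟨a, ha⟩ : lieL K X), ⁅(⟨b, hb⟩ : lieL K X), ⟨c, hc⟩⁆⁆, ?_, rfl⟩
  rw [LieModule.lowerCentralSeries_succ]
  refine LieSubmodule.lie_mem_lie (LieSubmodule.mem_top _) ?_
  rw [LieModule.lowerCentralSeries_succ]
  exact LieSubmodule.lie_mem_lie (LieSubmodule.mem_top _) (by simp)

theorem ι_mem_lieL (y : X) : FreeAlgebra.ι K y ∈ lieL K X :=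
  LieSubalgebra.subset_lieSpan ⟨y, rfl⟩

theorem fiveCommutators_subset_gammaIdeal (x y z : X) :
    ∀ g ∈ fiveCommutators (FreeAlgebra.ι K x) (FreeAlgebra.ι K y) (FreeAlgebra.ι K z),
      g ∈ gammaIdeal K X 2 := by
  have hx := ι_mem_lieL (K := K) x
  have hy := ι_mem_lieL (K := K) y
  have hz := ι_mem_lieL (K := K) z
  rintro g (rfl | rfl | rfl | rfl | rfl)
  · rw [← lie_skew]; exact neg_mem (lie_lie_mem_gammaIdeal hx hy hx)
  · exact lie_lie_mem_gammaIdeal hy hy hx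
  · exact lie_lie_mem_gammaIdeal hz hy hx
  · rw [← lie_skew]; exact neg_mem (lie_lie_mem_gammaIdeal hy hz hx)
  · exact lie_lie_mem_gammaIdeal ((lieL K X).lie_mem hz hy) hz hx

/-- The projection `K⟨X⟩ → K⟨X⟩/I`. -/
noncomputable def quotientMk (I : TwoSidedIdeal (FreeAlgebra K X)) :
    FreeAlgebra K X →ₐ[K] I.ringCon.Quotient :=
  { I.ringCon.mk' with commutes' := fun _ => rfl }

theorem quotientMk_eq_zero {I : TwoSidedIdeal (FreeAlgebra K X)} {f : FreeAlgebra K X} :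
    quotientMk I f = 0 ↔ f ∈ I := by
  rw [TwoSidedIdeal.mem_iff]
  exact RingCon.eq _

/-- The composite of `φ` with the projection modulo `I` makes commutators of variables central,
hence kills `I`. -/
theorem isSIdeal_gammaIdeal [LinearOrder X] :
    IsSIdeal (orderEnd K X) (gammaIdeal K X 2) := by
  rintro φ ⟨s, -, hφ⟩ f hf
  rw [← quotientMk_eq_zero]
  refine eq_zero_of_mem_gammaIdeal ((quotientMk _).comp φ) (fun i j k => ?_) hf
  simp only [AlgHom.comp_apply, hφ, ← map_commutator]
  exact quotientMk_eq_zero.2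
    (lie_lie_mem_gammaIdeal (ι_mem_lieL _) (ι_mem_lieL _) (ι_mem_lieL _))

end LowerCentral

/-! ### Deg-lex order and monic leading words -/

section Words

theorem shortlex_append_of_left {X : Type*} [LinearOrder X] {s t : List X}
    (h : List.Shortlex (· < ·) s t) (w : List X) : List.Shortlex (· < ·) (s ++ w) (t ++ w) := by
  rw [List.shortlex_def] at h ⊢
  rcases h with h | ⟨hl, h⟩
  · left; simpa using h
  · refine Or.inr ⟨by simpa using hl, ?_⟩
    induction h with
    -- Appending on the right can reverse the lexicographic order when one word is a proper prefix
    -- of the other; equal length excludes this.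
    | nil => simp at hl
    | cons _ ih => exact .cons (ih (by simpa using hl))
    | rel h => exact .rel h

theorem shortlex_trans {X : Type*} [LinearOrder X] {s t w : List X}
    (h : List.Shortlex (· < ·) s t) (h' : List.Shortlex (· < ·) t w) :
    List.Shortlex (· < ·) s w := by
  rw [List.shortlex_def] at *
  rcases h with h | ⟨hl, h⟩ <;> rcases h' with h' | ⟨hl', h'⟩
  · left; omega
  · left; omega
  · left; omega
  · exact Or.inr ⟨hl.trans hl', lt_trans (show s < t from h) (show t < w from h')⟩

theorem shortlex_irrefl {X : Type*} [LinearOrder X] (s : List X) :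
    ¬ List.Shortlex (· < ·) s s := by
  rw [List.shortlex_def]
  rintro (h | ⟨-, h⟩)
  · exact lt_irrefl _ h
  · exact List.lex_irrefl lt_irrefl s h

variable (K : Type u) [Field K] {X : Type v}

/-- The word `w` as an element of the free algebra. -/
noncomputable def monom (w : List X) : FreeAlgebra K X := (w.map (FreeAlgebra.ι K)).prod

theorem monom_append (u w : List X) : monom K (u ++ w) = monom K u * monom K w := by
  simp [monom]

theorem monom_singleton (x : X) : monom K [x] = FreeAlgebra.ι K x := by simp [monom]

theorem equiv_monom (w : List X) : FreeAlgebra.equivMonoidAlgebraFreeMonoid (monom K w) =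
    MonoidAlgebra.single (FreeMonoid.ofList w) 1 := by
  induction w with
  | nil => simp [monom]; rfl
  | cons a w ih =>
    have : monom K (a :: w) = FreeAlgebra.ι K a * monom K w := by simp [monom]
    rw [this, map_mul, ih]
    simp [FreeAlgebra.equivMonoidAlgebraFreeMonoid, MonoidAlgebra.of_apply,
      MonoidAlgebra.single_mul_single]

/-- The coefficient of a word. -/
noncomputable def wordCoeff (w : FreeMonoid X) : FreeAlgebra K X →ₗ[K] K where
  toFun f := (FreeAlgebra.equivMonoidAlgebraFreeMonoid f).coeff w
  map_add' _ _ := by simp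
  map_smul' _ _ := by simp

variable {K}

theorem mem_words {f : FreeAlgebra K X} {w : FreeMonoid X} :
    w ∈ words f ↔ wordCoeff K w f ≠ 0 := Finsupp.mem_support_iff

theorem wordCoeff_monom_of_ne {u : List X} {w : FreeMonoid X} (h : FreeMonoid.ofList u ≠ w) :
    wordCoeff K w (monom K u) = 0 := by
  simp [wordCoeff, equiv_monom, h]

theorem wordCoeff_monom_self (w : List X) :
    wordCoeff K (FreeMonoid.ofList w) (monom K w) = 1 := by
  simp [wordCoeff, equiv_monom]

theorem sum_words (f : FreeAlgebra K X) :
    f = ∑ w ∈ words f, wordCoeff K w f • monom K w.toList := by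
  apply FreeAlgebra.equivMonoidAlgebraFreeMonoid.injective
  simp only [map_sum, map_smul, equiv_monom, FreeMonoid.ofList_toList]
  conv_lhs => rw [← MonoidAlgebra.sum_coeff_single (FreeAlgebra.equivMonoidAlgebraFreeMonoid f)]
  simp [Finsupp.sum, words, wordCoeff]

variable [LinearOrder X]

variable (K) in
/-- The span of the words smaller than `w`. -/
noncomputable def lowerSpan (w : List X) : Submodule K (FreeAlgebra K X) :=
  Submodule.span K (monom K '' {v | List.Shortlex (· < ·) v w})

theorem monom_mem_lowerSpan {u w : List X} (h : List.Shortlex (· < ·) u w) :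
    monom K u ∈ lowerSpan K w := Submodule.subset_span ⟨u, h, rfl⟩

theorem lowerSpan_mono {u w : List X} (h : List.Shortlex (· < ·) u w) :
    lowerSpan K u ≤ lowerSpan K w := by
  refine Submodule.span_mono (Set.image_mono fun v hv => shortlex_trans hv h)

theorem mul_mem_lowerSpan_of_left {f : FreeAlgebra K X} {u : List X} (hf : f ∈ lowerSpan K u)
    (w : List X) : f * monom K w ∈ lowerSpan K (u ++ w) := by
  have : lowerSpan K u ≤ (lowerSpan K (u ++ w)).comap (LinearMap.mulRight K (monom K w)) := by
    refine Submodule.span_le.2 ?_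
    rintro _ ⟨v, hv, rfl⟩
    simp only [Submodule.comap_coe, Set.mem_preimage, LinearMap.mulRight_apply, ← monom_append]
    exact monom_mem_lowerSpan (shortlex_append_of_left hv w)
  exact this hf

theorem mul_mem_lowerSpan_of_right {f : FreeAlgebra K X} {w : List X} (hf : f ∈ lowerSpan K w)
    (u : List X) : monom K u * f ∈ lowerSpan K (u ++ w) := by
  have : lowerSpan K w ≤ (lowerSpan K (u ++ w)).comap (LinearMap.mulLeft K (monom K u)) := by
    refine Submodule.span_le.2 ?_
    rintro _ ⟨v, hv, rfl⟩
    simp only [Submodule.comap_coe, Set.mem_preimage, LinearMap.mulLeft_apply, ← monom_append]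
    exact monom_mem_lowerSpan (hv.append_left u)
  exact this hf

theorem mul_mem_lowerSpan {f g : FreeAlgebra K X} {u w : List X} (hf : f ∈ lowerSpan K u)
    (hg : g ∈ lowerSpan K w) : f * g ∈ lowerSpan K (u ++ w) := by
  have : lowerSpan K w ≤ (lowerSpan K (u ++ w)).comap (LinearMap.mulLeft K f) := by
    refine Submodule.span_le.2 ?_
    rintro _ ⟨v, hv, rfl⟩
    exact lowerSpan_mono (hv.append_left u) (mul_mem_lowerSpan_of_left hf v)
  exact this hg

/-- `f` has the leading word `w`, with coefficient one. -/
def HasMonicLeadingWord (f : FreeAlgebra K X) (w : List X) : Prop :=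
  f - monom K w ∈ lowerSpan K w

namespace HasMonicLeadingWord

theorem monom (w : List X) : HasMonicLeadingWord (monom K w) w := by
  simp [HasMonicLeadingWord]

theorem ι (x : X) : HasMonicLeadingWord (FreeAlgebra.ι K x) [x] := by
  rw [← monom_singleton]; exact monom _

theorem mul {f g : FreeAlgebra K X} {u w : List X} (hf : HasMonicLeadingWord f u)
    (hg : HasMonicLeadingWord g w) : HasMonicLeadingWord (f * g) (u ++ w) := by
  have : f * g - GroebnerS.monom K (u ++ w) =
      (f - GroebnerS.monom K u) * (g - GroebnerS.monom K w) +
      (f - GroebnerS.monom K u) * GroebnerS.monom K w +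
      GroebnerS.monom K u * (g - GroebnerS.monom K w) := by
    rw [monom_append]; noncomm_ring
  rw [HasMonicLeadingWord, this]
  exact add_mem (add_mem (mul_mem_lowerSpan hf hg) (mul_mem_lowerSpan_of_left hf w))
    (mul_mem_lowerSpan_of_right hg u)

theorem mem_lowerSpan {f : FreeAlgebra K X} {u w : List X} (hf : HasMonicLeadingWord f u)
    (h : List.Shortlex (· < ·) u w) : f ∈ lowerSpan K w := by
  rw [← sub_add_cancel f (GroebnerS.monom K u)]
  exact add_mem (lowerSpan_mono h hf) (monom_mem_lowerSpan h)

theorem commutator {f g : FreeAlgebra K X} {u w : List X} (hf : HasMonicLeadingWord f u)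
    (hg : HasMonicLeadingWord g w) (h : List.Shortlex (· < ·) (w ++ u) (u ++ w)) :
    HasMonicLeadingWord ⁅f, g⁆ (u ++ w) := by
  rw [HasMonicLeadingWord, LieRing.of_associative_ring_bracket, sub_right_comm]
  exact sub_mem (hf.mul hg) ((hg.mul hf).mem_lowerSpan h)

theorem isLeadingWord {f : FreeAlgebra K X} {w : List X} (hf : HasMonicLeadingWord f w) :
    IsLeadingWord WordDegLex f (FreeMonoid.ofList w) := by
  -- `f` differs from the word `w` only in words below `w`.
  have key : ∀ v : FreeMonoid X, ¬ List.Shortlex (· < ·) v.toList w →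
      wordCoeff K v f = wordCoeff K v (GroebnerS.monom K w) := by
    intro v hv
    have : lowerSpan K w ≤ LinearMap.ker (wordCoeff K v) := by
      refine Submodule.span_le.2 ?_
      rintro _ ⟨u, hu, rfl⟩
      refine wordCoeff_monom_of_ne ?_
      rintro rfl
      exact hv hu
    have := this hf
    rwa [LinearMap.mem_ker, map_sub, sub_eq_zero] at this
  constructor
  · rw [mem_words, key (FreeMonoid.ofList w) (shortlex_irrefl w), wordCoeff_monom_self]
    exact one_ne_zero
  · intro v hv hne
    by_contra hlt
    rw [mem_words, key v hlt] at hv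
    exact hv (wordCoeff_monom_of_ne hne.symm)

end HasMonicLeadingWord

theorem IsLeadingWord.sub_smul_mem_lowerSpan {f : FreeAlgebra K X} {w : FreeMonoid X}
    (hf : IsLeadingWord WordDegLex f w) :
    f - wordCoeff K w f • monom K w.toList ∈ lowerSpan K w.toList := by
  classical
  have := sum_words f
  rw [← Finset.add_sum_erase _ _ hf.1] at this
  rw [sub_eq_of_eq_add' this]
  refine Submodule.sum_mem _ fun v hv => Submodule.smul_mem _ _ (monom_mem_lowerSpan ?_)
  rw [Finset.mem_erase] at hv
  exact hf.2 v hv.2 hv.1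

theorem exists_isLeadingWord {f : FreeAlgebra K X} (hf : f ≠ 0) :
    ∃ w, IsLeadingWord WordDegLex f w := by
  have hne : (words f).Nonempty := by
    rw [Finset.nonempty_iff_ne_empty]
    intro h
    apply hf
    rw [sum_words f, h, Finset.sum_empty]
  suffices ∀ s : Finset (FreeMonoid X), s.Nonempty →
      ∃ w ∈ s, ∀ v ∈ s, v ≠ w → WordDegLex v w from this _ hne
  intro s hs
  induction hs using Finset.Nonempty.cons_induction with
  | singleton a => exact ⟨a, by simp, by simp⟩
  | cons a s ha _ ih =>
    obtain ⟨w, hw, hmax⟩ := ih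
    rcases trichotomous_of (List.Shortlex (· < ·)) a.toList w.toList with h | h | h
    · refine ⟨w, by simp [hw], fun v hv hne => ?_⟩
      rcases Finset.mem_cons.1 hv with rfl | hv
      · exact h
      · exact hmax v hv hne
    · rw [FreeMonoid.toList.injective h] at ha
      exact absurd hw ha
    · refine ⟨a, by simp, fun v hv hne => ?_⟩
      rcases Finset.mem_cons.1 hv with rfl | hv
      · exact absurd rfl hne
      · by_cases hvw : v = w
        · rw [hvw]; exact h
        · exact shortlex_trans (hmax v hv hvw) h

end Words

/-! ### Words avoiding the five patterns -/

section Obstructions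

variable {X : Type v} [LinearOrder X]

/-- The leading words of the images of the five commutators. -/
inductive Obstruction : List X → Prop
  | baa {a b : X} : a < b → Obstruction [b, a, a]
  | bba {a b : X} : a < b → Obstruction [b, b, a]
  | cba {a b c : X} : a < b → b < c → Obstruction [c, b, a]
  | cab {a b c : X} : a < b → b < c → Obstruction [c, a, b]
  | cbca {a b c : X} : a < b → b < c → Obstruction [c, b, c, a]

/-- `(c, c)` stands for the letter `c`, and `(c, a)` with `a < c` for the commutator of `c` and
`a`. -/
def genWord (g : X × X) : List X := if g.2 = g.1 then [g.1] else [g.1, g.2]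

/-- The leading word of a product of letters and commutators. -/
def spell (l : List (X × X)) : List X := (l.map genWord).flatten

theorem genWord_self (c : X) : genWord (c, c) = [c] := by simp [genWord]

theorem genWord_of_lt {c a : X} (h : a < c) : genWord (c, a) = [c, a] := by
  simp [genWord, h.ne]

theorem spell_cons (g : X × X) (l : List (X × X)) : spell (g :: l) = genWord g ++ spell l := by
  simp [spell]

/-- The lists of letters and commutators that are increasing, with repetitions allowed, for the
lexicographic order on pairs. -/
def Standard (l : List (X × X)) : Prop :=
  l.Pairwise (fun g h => toLex g ≤ toLex h) ∧ ∀ g ∈ l, g.2 ≤ g.1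

theorem Standard.cons {g h : X × X} {l : List (X × X)} (hl : Standard (h :: l))
    (hg : g.2 ≤ g.1) (hgh : toLex g ≤ toLex h) : Standard (g :: h :: l) := by
  refine ⟨List.pairwise_cons.2 ⟨?_, hl.1⟩, ?_⟩
  · intro k hk
    rcases List.mem_cons.1 hk with rfl | hk
    · exact hgh
    · exact hgh.trans ((List.pairwise_cons.1 hl.1).1 k hk)
  · intro k hk
    rcases List.mem_cons.1 hk with rfl | hk
    · exact hg
    · exact hl.2 k hk

theorem Standard.tail {g : X × X} {l : List (X × X)} (hl : Standard (g :: l)) : Standard l :=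
  ⟨hl.1.of_cons, fun k hk => hl.2 k (List.mem_cons_of_mem _ hk)⟩

theorem standard_singleton {g : X × X} (hg : g.2 ≤ g.1) : Standard [g] := by
  simp [Standard, hg]

/-- Commutative monomials only remember a list up to permutation; this recovers the standard list
from its monomial. -/
theorem Standard.eq_of_perm {l m : List (X × X)} (hl : Standard l) (hm : Standard m)
    (h : l.Perm m) : l = m :=
  h.eq_of_pairwise (fun _ _ _ _ h₁ h₂ => toLex.injective (le_antisymm h₁ h₂)) hl.1 hm.1

/-- A word without obstructions is spelled by a standard list. -/
theorem exists_obstruction_or_standard (w : List X) :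
    (∃ a t b, Obstruction t ∧ w = a ++ t ++ b) ∨ ∃ l, Standard l ∧ spell l = w := by
  induction w with
  | nil => exact Or.inr ⟨[], by simp [Standard], rfl⟩
  | cons c w ih =>
    rcases ih with ⟨a, t, b, ht, rfl⟩ | ⟨l, hl, rfl⟩
    · exact Or.inl ⟨c :: a, t, b, ht, rfl⟩
    rcases l with - | ⟨⟨b, a⟩, l⟩
    · exact Or.inr ⟨[(c, c)], standard_singleton le_rfl, by simp [spell, genWord]⟩
    have hab : a ≤ b := hl.2 _ List.mem_cons_self
    rcases lt_or_ge c b with hcb | hbc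
    · refine Or.inr ⟨(c, c) :: (b, a) :: l, hl.cons le_rfl ?_, ?_⟩
      · exact Prod.Lex.toLex_le_toLex.2 (Or.inl hcb)
      · simp [spell_cons, genWord_self]
    rcases hab.lt_or_eq with hab | rfl
    · refine Or.inl ⟨[], [c, b, a], spell l, ?_, by simp [spell_cons, genWord_of_lt hab]⟩
      rcases hbc.lt_or_eq with hbc | rfl
      · exact .cba hab hbc
      · exact .bba hab
    rcases hbc.eq_or_lt with rfl | hac
    · refine Or.inr ⟨(a, a) :: (a, a) :: l, hl.cons le_rfl le_rfl, ?_⟩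
      simp [spell_cons, genWord_self]
    -- The list starts with the letter `a < c`, so `c` cannot precede it as a letter and is merged
    -- with it into `(c, a)`. This is standard unless the next pair `(d, e)` is smaller than `(c,
    -- a)`: then `d < c` yields the pattern `baa` or `cab`, and `d = c`, `e < a` yields `cbca`.
    rcases l with - | ⟨⟨d, e⟩, l⟩
    · exact Or.inr ⟨[(c, a)], standard_singleton hac.le, by
        simp [genWord_self, genWord_of_lt hac, spell]⟩
    have hed : e ≤ d := hl.tail.2 _ List.mem_cons_self
    have had := Prod.Lex.toLex_le_toLex.1 ((List.pairwise_cons.1 hl.1).1 _ List.mem_cons_self)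
    simp only at had
    have had' : a ≤ d := by
      rcases had with h | h
      · exact h.le
      · exact h.1.le
    have hspell : ∃ r, genWord (d, e) = d :: r := by
      unfold genWord
      split_ifs <;> exact ⟨_, rfl⟩
    obtain ⟨r, hr⟩ := hspell
    rcases lt_or_ge d c with hdc | hcd
    · refine Or.inl ⟨[], [c, a, d], r ++ spell l, ?_, by simp [spell_cons, genWord_self, hr]⟩
      rcases had'.lt_or_eq with h | rfl
      · exact .cab h hdc
      · exact .baa hac
    have good : toLex (c, a) ≤ toLex (d, e) → ∃ l', Standard l' ∧
        spell l' = c :: spell ((a, a) :: (d, e) :: l) := fun h =>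
      ⟨(c, a) :: (d, e) :: l, hl.tail.cons hac.le h, by
        simp [spell_cons, genWord_self, genWord_of_lt hac]⟩
    rcases hcd.lt_or_eq with hcd | rfl
    · exact Or.inr (good (Prod.Lex.toLex_le_toLex.2 (Or.inl hcd)))
    · rcases le_or_gt a e with hae | hea
      · exact Or.inr (good (Prod.Lex.toLex_le_toLex.2 (Or.inr ⟨rfl, hae⟩)))
      · refine Or.inl ⟨[], [c, a, c, e], spell l, .cbca hea hac, ?_⟩
        simp [spell_cons, genWord_self, genWord_of_lt (hea.trans hac)]

end Obstructions

/-! ### Each obstruction leads an element of the orbit -/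

section LeadingWords

variable {K : Type u} [Field K] {X : Type v} [LinearOrder X]

theorem hasMonicLeadingWord_lie_ι {a b : X} (h : a < b) :
    HasMonicLeadingWord ⁅FreeAlgebra.ι K b, FreeAlgebra.ι K a⁆ [b, a] :=
  (HasMonicLeadingWord.ι b).commutator (.ι a) (.of_lex rfl (.rel h))

theorem exists_strictMono (x : ℕ+ ≃o X) {a b c : X} (hab : a < b) (hbc : b < c) :
    ∃ s : X → X, StrictMono s ∧ s (x 1) = a ∧ s (x 2) = b ∧ s (x 3) = c := by
  -- Indices are shifted by one: `t n` is the image of `x (n + 1)`. From `n = 2` on, `t` runs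
  -- through `c` and its successors in the enumeration.
  let t : ℕ → X
    | 0 => a
    | 1 => b
    | n + 2 => x (Nat.succPNat ((x.symm c).natPred + n))
  have ht2 : t 2 = c := by simp [t]
  have ht : StrictMono t := by
    refine strictMono_nat_of_lt_succ fun n => ?_
    match n with
    | 0 => exact hab
    | 1 => exact ht2 ▸ hbc
    | n + 2 =>
      refine x.strictMono (Nat.succPNat_strictMono ?_)
      omega
  exact ⟨fun y => t (x.symm y).natPred,
    fun y z h => ht (PNat.natPred_strictMono (x.symm.strictMono h)),
    congrArg (fun n => t n.natPred) (x.symm_apply_apply 1),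
    congrArg (fun n => t n.natPred) (x.symm_apply_apply 2),
    (congrArg (fun n : ℕ+ => t n.natPred) (x.symm_apply_apply 3)).trans ht2⟩

theorem fiveCommutators_subset_orbit (x : ℕ+ ≃o X) {a b c : X} (hab : a < b) (hbc : b < c) :
    fiveCommutators (FreeAlgebra.ι K a) (FreeAlgebra.ι K b) (FreeAlgebra.ι K c) ⊆
      orbit (orderEnd K X) (fiveCommutators
        (FreeAlgebra.ι K (x 1)) (FreeAlgebra.ι K (x 2)) (FreeAlgebra.ι K (x 3))) := by
  obtain ⟨s, hs, rfl, rfl, rfl⟩ := exists_strictMono x hab hbc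
  have h : ∀ g, ∀ y, FreeAlgebra.lift K (FreeAlgebra.ι K ∘ s) g = y → g ∈ fiveCommutators
        (FreeAlgebra.ι K (x 1)) (FreeAlgebra.ι K (x 2)) (FreeAlgebra.ι K (x 3)) →
      y ∈ orbit (orderEnd K X) (fiveCommutators
        (FreeAlgebra.ι K (x 1)) (FreeAlgebra.ι K (x 2)) (FreeAlgebra.ι K (x 3))) :=
    fun g y hy hg => ⟨FreeAlgebra.lift K (FreeAlgebra.ι K ∘ s), ⟨s, hs, by simp⟩, g, hg, hy⟩
  rintro g (rfl | rfl | rfl | rfl | rfl)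
  · exact h _ _ (by
      simp only [map_commutator, FreeAlgebra.lift_ι_apply, Function.comp]) (Or.inl rfl)
  · exact h _ _ (by
      simp only [map_commutator, FreeAlgebra.lift_ι_apply, Function.comp]) (Or.inr (Or.inl rfl))
  · exact h _ _ (by
      simp only [map_commutator, FreeAlgebra.lift_ι_apply, Function.comp]) (Or.inr (Or.inr (Or.inl rfl)))
  · exact h _ _ (by
      simp only [map_commutator, FreeAlgebra.lift_ι_apply, Function.comp]) (Or.inr (Or.inr (Or.inr (Or.inl rfl))))
  · exact h _ _ (by
      simp only [map_commutator, FreeAlgebra.lift_ι_apply, Function.comp]) (Or.inr (Or.inr (Or.inr (Or.inr rfl))))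

theorem Obstruction.exists_mem_orbit (x : ℕ+ ≃o X) {t : List X} (ht : Obstruction t) :
    ∃ g ∈ orbit (orderEnd K X) (fiveCommutators
        (FreeAlgebra.ι K (x 1)) (FreeAlgebra.ι K (x 2)) (FreeAlgebra.ι K (x 3))),
      HasMonicLeadingWord g t := by
  -- The two-letter patterns also need a third letter, as the image of `x 3`.
  have hlt : ∀ b : X, ∃ c, b < c := fun b =>
    ⟨x (x.symm b + 1), by rw [← x.symm.lt_iff_lt]; simp⟩
  cases ht with
  | @baa a b h =>
    obtain ⟨c, hc⟩ := hlt b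
    exact ⟨_, fiveCommutators_subset_orbit x h hc (Or.inl rfl),
      (hasMonicLeadingWord_lie_ι h).commutator (.ι a) (.of_lex rfl (.rel h))⟩
  | @bba a b h =>
    obtain ⟨c, hc⟩ := hlt b
    exact ⟨_, fiveCommutators_subset_orbit x h hc (Or.inr (Or.inl rfl)),
      (HasMonicLeadingWord.ι b).commutator (hasMonicLeadingWord_lie_ι h)
        (.of_lex rfl (.cons (.rel h)))⟩
  | @cba a b c h h' =>
    exact ⟨_, fiveCommutators_subset_orbit x h h' (Or.inr (Or.inr (Or.inl rfl))),
      (HasMonicLeadingWord.ι c).commutator (hasMonicLeadingWord_lie_ι h)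
        (.of_lex rfl (.rel h'))⟩
  | @cab a b c h h' =>
    exact ⟨_, fiveCommutators_subset_orbit x h h' (Or.inr (Or.inr (Or.inr (Or.inl rfl)))),
      (hasMonicLeadingWord_lie_ι (h.trans h')).commutator (.ι b) (.of_lex rfl (.rel h'))⟩
  | @cbca a b c h h' =>
    exact ⟨_, fiveCommutators_subset_orbit x h h' (Or.inr (Or.inr (Or.inr (Or.inr rfl)))),
      (hasMonicLeadingWord_lie_ι h').commutator (hasMonicLeadingWord_lie_ι (h.trans h'))
        (.of_lex rfl (.cons (.rel h)))⟩

end LeadingWords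

/-! ### The polynomial representation and PBW products -/

section Representation

open MvPolynomial

variable (K : Type u) [Field K] {X : Type v} [LinearOrder X]

/-- The derivation of the polynomial ring by which the letter `c` acts. -/
noncomputable def letterDerivation (c : X) :
    Derivation K (MvPolynomial (X × X) K) (MvPolynomial (X × X) K) :=
  mkDerivation K fun p => if p.2 = p.1 ∧ p.1 < c then MvPolynomial.X (c, p.1) else 0

/-- The action of the letter `c` on the polynomial ring. -/
noncomputable def letterAction (c : X) : Module.End K (MvPolynomial (X × X) K) :=
  LinearMap.mulLeft K (MvPolynomial.X (c, c)) + (letterDerivation K c).toLinearMap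

theorem letterDerivation_X (c : X) (p : X × X) : letterDerivation K c (MvPolynomial.X p) =
    if p.2 = p.1 ∧ p.1 < c then MvPolynomial.X (c, p.1) else 0 :=
  mkDerivation_X _ _ _

/-- The first derivation gives zero or an off-diagonal variable, and these are killed by every
letter derivation. -/
theorem letterDerivation_letterDerivation_X (b c : X) (p : X × X) :
    letterDerivation K b (letterDerivation K c (MvPolynomial.X p)) = 0 := by
  rw [letterDerivation_X]
  split_ifs with h
  · rw [letterDerivation_X, if_neg]
    rintro ⟨h', -⟩
    exact h.2.ne h'
  · simp

theorem letterDerivation_comm (b c : X) (p : MvPolynomial (X × X) K) :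
    letterDerivation K b (letterDerivation K c p) =
      letterDerivation K c (letterDerivation K b p) := by
  have : ⁅letterDerivation K b, letterDerivation K c⁆ = 0 := by
    refine derivation_ext fun i => ?_
    simp [Derivation.commutator_apply, letterDerivation_letterDerivation_X]
  have := congrArg (fun D => D p) this
  simpa [Derivation.commutator_apply, sub_eq_zero] using this

/-- The derivation parts commute and the multiplications commute, so only the mixed terms of the
Leibniz rule survive. -/
theorem lie_letterAction (b c : X) : ⁅letterAction K b, letterAction K c⁆ =
    LinearMap.mulLeft K (letterDerivation K b (MvPolynomial.X (c, c)) -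
      letterDerivation K c (MvPolynomial.X (b, b))) := by
  refine LinearMap.ext fun p => ?_
  simp only [LieRing.of_associative_ring_bracket, letterAction, LinearMap.sub_apply,
    Module.End.mul_apply, LinearMap.add_apply, LinearMap.mulLeft_apply, map_add,
    Derivation.coeFn_coe, Derivation.leibniz, smul_eq_mul]
  rw [letterDerivation_comm K b c p]
  ring

theorem lie_letterAction_of_lt {a c : X} (h : a < c) : ⁅letterAction K c, letterAction K a⁆ =
    LinearMap.mulLeft K (MvPolynomial.X (c, a)) := by
  rw [lie_letterAction, letterDerivation_X, letterDerivation_X, if_pos ⟨rfl, h⟩,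
    if_neg (fun h' => h.asymm h'.2), sub_zero]

/-- The inner commutator is multiplication by a polynomial that every letter derivation kills, so it
commutes with the letters. -/
theorem lie_lie_letterAction (a b c : X) :
    ⁅letterAction K a, ⁅letterAction K b, letterAction K c⁆⁆ = 0 := by
  rw [lie_letterAction]
  refine LinearMap.ext fun p => ?_
  simp only [LieRing.of_associative_ring_bracket, letterAction, LinearMap.sub_apply,
    Module.End.mul_apply, LinearMap.add_apply, LinearMap.mulLeft_apply, map_sub,
    Derivation.coeFn_coe, Derivation.leibniz, smul_eq_mul,
    letterDerivation_letterDerivation_X, LinearMap.zero_apply]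
  ring

/-- The representation of the free algebra on the polynomial ring. -/
noncomputable def action : FreeAlgebra K X →ₐ[K] Module.End K (MvPolynomial (X × X) K) :=
  FreeAlgebra.lift K (letterAction K)

theorem action_eq_zero {f : FreeAlgebra K X} (hf : f ∈ gammaIdeal K X 2) : action K f = 0 :=
  eq_zero_of_mem_gammaIdeal _ (fun i j k => by simp [action, lie_lie_letterAction]) hf

/-- The symbol of an element of the free algebra: its effect on the polynomial `1`. -/
noncomputable def symbol : FreeAlgebra K X →ₗ[K] MvPolynomial (X × X) K :=
  (LinearMap.applyₗ 1).comp (action K).toLinearMap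

theorem symbol_apply (f : FreeAlgebra K X) : symbol K f = action K f 1 := rfl

theorem symbol_eq_zero {f : FreeAlgebra K X} (hf : f ∈ gammaIdeal K X 2) : symbol K f = 0 := by
  rw [symbol_apply, action_eq_zero K hf, LinearMap.zero_apply]

/-- The letter or commutator for which a pair stands. -/
noncomputable def genElement (g : X × X) : FreeAlgebra K X :=
  if g.2 = g.1 then FreeAlgebra.ι K g.1 else ⁅FreeAlgebra.ι K g.1, FreeAlgebra.ι K g.2⁆

/-- The product of letters and commutators for which a list of pairs stands. -/
noncomputable def pbwElement (l : List (X × X)) : FreeAlgebra K X := (l.map (genElement K)).prod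

variable {K}

theorem hasMonicLeadingWord_pbwElement {l : List (X × X)} (hl : ∀ g ∈ l, g.2 ≤ g.1) :
    HasMonicLeadingWord (pbwElement K l) (spell l) := by
  induction l with
  | nil => exact .monom []
  | cons g l ih =>
    have : pbwElement K (g :: l) = genElement K g * pbwElement K l := by simp [pbwElement]
    rw [this, spell_cons]
    refine HasMonicLeadingWord.mul ?_ (ih fun k hk => hl k (List.mem_cons_of_mem _ hk))
    unfold genElement genWord
    split_ifs with h
    · exact .ι _
    · exact hasMonicLeadingWord_lie_ι (lt_of_le_of_ne (hl g List.mem_cons_self) h)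

theorem derivation_prod_eq_zero {R A M ι : Type*} [CommRing R] [CommRing A] [Algebra R A]
    [AddCommGroup M] [Module A M] [Module R M] (D : Derivation R A M) (f : ι → A) (l : List ι)
    (h : ∀ i ∈ l, D (f i) = 0) : D (l.map f).prod = 0 := by
  induction l with
  | nil => simp
  | cons i l ih =>
    rw [List.map_cons, List.prod_cons, Derivation.leibniz, h i List.mem_cons_self,
      ih fun j hj => h j (List.mem_cons_of_mem _ hj)]
    simp

/-- Commutators act by multiplication. For a letter `c` the derivation contributes nothing: it sees
only variables `(a, a)` with `a < c`, and in a standard list no later pair has first entry below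
`c`. -/
theorem symbol_pbwElement {l : List (X × X)} (hl : Standard l) :
    symbol K (pbwElement K l) = (l.map MvPolynomial.X).prod := by
  induction l with
  | nil => simp [pbwElement, symbol_apply]
  | cons g l ih =>
    have : pbwElement K (g :: l) = genElement K g * pbwElement K l := by simp [pbwElement]
    rw [this, symbol_apply, map_mul, Module.End.mul_apply, ← symbol_apply, ih hl.tail,
      List.map_cons, List.prod_cons]
    obtain ⟨c, a⟩ := g
    unfold genElement
    split_ifs with h
    · obtain rfl : a = c := h
      simp only [action, FreeAlgebra.lift_ι_apply, letterAction, LinearMap.add_apply,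
        LinearMap.mulLeft_apply, add_eq_left]
      refine derivation_prod_eq_zero _ _ _ fun k hk => ?_
      rw [letterDerivation_X, if_neg]
      rintro ⟨-, hka⟩
      have := Prod.Lex.toLex_le_toLex.1 ((List.pairwise_cons.1 hl.1).1 k hk)
      rcases this with h | h
      · exact h.asymm hka
      · exact hka.ne h.1.symm
    · have hac : a < c := lt_of_le_of_ne (hl.2 _ List.mem_cons_self) h
      simp only [action, map_commutator, FreeAlgebra.lift_ι_apply]
      rw [lie_letterAction_of_lt K hac, LinearMap.mulLeft_apply]

theorem list_prod_X {σ : Type*} [DecidableEq σ] (l : List σ) :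
    (l.map (MvPolynomial.X (R := K))).prod = monomial (Multiset.toFinsupp (l : Multiset σ)) 1 := by
  induction l with
  | nil => simp
  | cons g l ih =>
    rw [List.map_cons, List.prod_cons, ih, ← Multiset.cons_coe, ← Multiset.singleton_add,
      map_add, Multiset.toFinsupp_singleton, MvPolynomial.X, monomial_mul, one_mul]

end Representation

/-! ### Reduction to standard monomials and the Gröbner basis -/

section Reduction

open MvPolynomial

variable (K : Type u) [Field K] {X : Type v} [LinearOrder X]

/-- The span of the monomials of the standard lists that spell a word smaller than `w`. -/
noncomputable def standardLowerSpan (w : List X) : Submodule K (MvPolynomial (X × X) K) :=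
  Submodule.span K ((fun l => (l.map MvPolynomial.X).prod) ''
    {l | Standard l ∧ List.Shortlex (· < ·) (spell l) w})

variable {K}

theorem standardLowerSpan_mono {u w : List X} (h : List.Shortlex (· < ·) u w) :
    standardLowerSpan K u ≤ standardLowerSpan K w :=
  Submodule.span_mono (Set.image_mono fun _ hl => ⟨hl.1, shortlex_trans hl.2 h⟩)

theorem symbol_mul_mul_eq_zero {f : FreeAlgebra K X} (hf : f ∈ gammaIdeal K X 2)
    (g h : FreeAlgebra K X) : symbol K (g * f * h) = 0 :=
  symbol_eq_zero K (TwoSidedIdeal.mul_mem_right _ _ _ (TwoSidedIdeal.mul_mem_left _ _ _ hf))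

/-- Each polynomial that is the symbol of a combination of words smaller than `w` is a combination
of monomials of standard lists spelling words smaller than `w`. -/
theorem symbol_mem_standardLowerSpan (x : ℕ+ ≃o X) (w : List X) {f : FreeAlgebra K X}
    (hf : f ∈ lowerSpan K w) : symbol K f ∈ standardLowerSpan K w := by
  -- The enumeration makes `X` well-ordered, hence also the deg-lex order.
  have hwf : WellFounded ((· < ·) : X → X → Prop) :=
    (x.symm.toRelIsoLT.toRelEmbedding).wellFounded wellFounded_lt
  induction w using (List.Shortlex.wf hwf).induction generalizing f with
  | _ w ih =>
    suffices lowerSpan K w ≤ (standardLowerSpan K w).comap (symbol K) from this hf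
    refine Submodule.span_le.2 ?_
    rintro _ ⟨u, hu, rfl⟩
    change symbol K (monom K u) ∈ standardLowerSpan K w
    rcases exists_obstruction_or_standard u with ⟨a, t, b, ht, rfl⟩ | ⟨l, hl, rfl⟩
    · obtain ⟨g, hg, hgt⟩ := ht.exists_mem_orbit (K := K) x
      have hgI : g ∈ gammaIdeal K X 2 := by
        obtain ⟨φ, hφ, g', hg', rfl⟩ := hg
        exact isSIdeal_gammaIdeal φ hφ _ (fiveCommutators_subset_gammaIdeal _ _ _ _ hg')
      -- The product of `a`, `g`, `b` lies in `I`, so its symbol is zero, and it differs from the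
      -- word `u` by smaller words.
      have key := ((HasMonicLeadingWord.monom a).mul hgt).mul (.monom b)
      have := standardLowerSpan_mono hu (ih _ hu key)
      rwa [map_sub, symbol_mul_mul_eq_zero hgI, zero_sub, neg_mem_iff] at this
    -- Here `u` is replaced by the PBW product that it leads, whose symbol is a standard monomial.
    · have := standardLowerSpan_mono hu (ih _ hu (hasMonicLeadingWord_pbwElement hl.2))
      rw [map_sub, symbol_pbwElement hl] at this
      have hmem : (l.map MvPolynomial.X).prod ∈ standardLowerSpan K w :=
        Submodule.subset_span ⟨l, ⟨hl, hu⟩, rfl⟩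
      exact (Submodule.sub_mem_iff_right _ hmem).1 this

theorem standardLowerSpan_coeff_eq_zero [DecidableEq (X × X)] {l : List (X × X)} (hl : Standard l)
    {p : MvPolynomial (X × X) K} (hp : p ∈ standardLowerSpan K (spell l)) :
    coeff (Multiset.toFinsupp (l : Multiset (X × X))) p = 0 := by
  suffices standardLowerSpan K (spell l) ≤ LinearMap.ker
      (lcoeff K (Multiset.toFinsupp (l : Multiset (X × X)))) from this hp
  refine Submodule.span_le.2 ?_
  rintro _ ⟨m, ⟨hm, hml⟩, rfl⟩
  simp only [SetLike.mem_coe, LinearMap.mem_ker, lcoeff_apply, list_prod_X, coeff_monomial]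
  rw [if_neg]
  intro h
  have := hm.eq_of_perm hl (Multiset.coe_eq_coe.1 (Multiset.toFinsupp.injective h))
  exact shortlex_irrefl _ (this ▸ hml)

theorem exists_obstruction_of_isLeadingWord (x : ℕ+ ≃o X) {f : FreeAlgebra K X}
    (hf : f ∈ gammaIdeal K X 2) {w : FreeMonoid X} (hw : IsLeadingWord WordDegLex f w) :
    ∃ a t b, Obstruction t ∧ w.toList = a ++ t ++ b := by
  classical
  refine (exists_obstruction_or_standard w.toList).resolve_right ?_
  rintro ⟨l, hl, hlw⟩
  -- As `f` has symbol zero, `h₁` puts the symbol of the word `w` among smaller standard monomials;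
  -- with `h₂` the monomial of `l` itself lands there, against its coefficient `1`.
  have h₁ := symbol_mem_standardLowerSpan x _ hw.sub_smul_mem_lowerSpan
  have h₂ := symbol_mem_standardLowerSpan x _ (hasMonicLeadingWord_pbwElement (K := K) hl.2)
  rw [map_sub, symbol_eq_zero K hf, zero_sub, neg_mem_iff, map_smul, ← hlw] at h₁
  have h₃ := (Submodule.smul_mem_iff _ (mem_words.1 hw.1)).1 h₁
  have h₄ := standardLowerSpan_coeff_eq_zero hl (add_mem h₂ h₃)
  rw [map_sub, sub_add_cancel, symbol_pbwElement hl, list_prod_X, coeff_monomial, if_pos rfl] at h₄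
  exact one_ne_zero h₄

theorem isGroebnerSBasis_fiveCommutators (x : ℕ+ ≃o X) :
    IsGroebnerSBasis WordDegLex (orderEnd K X)
      (fiveCommutators (FreeAlgebra.ι K (x 1)) (FreeAlgebra.ι K (x 2)) (FreeAlgebra.ι K (x 3)))
      (gammaIdeal K X 2) := by
  refine ⟨isSIdeal_gammaIdeal, fiveCommutators_subset_gammaIdeal _ _ _, ?_, ?_⟩
  · rintro _ ⟨φ, hφ, g, hg, rfl⟩
    exact isSIdeal_gammaIdeal φ hφ _ (fiveCommutators_subset_gammaIdeal _ _ _ _ hg)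
  · intro f hf hne
    obtain ⟨w, hw⟩ := exists_isLeadingWord hne
    obtain ⟨a, t, b, ht, hab⟩ := exists_obstruction_of_isLeadingWord x hf hw
    obtain ⟨g, hg, hgt⟩ := ht.exists_mem_orbit (K := K) x
    exact ⟨g, hg, _, w, hgt.isLeadingWord, hw, .ofList a, .ofList b, hab⟩

end Reduction

/-! ### The isomorphism with the enveloping algebra -/

section Enveloping

variable (K : Type u) [Field K] (X : Type v)

/-- The map from the free algebra to the enveloping algebra of the free nilpotent Lie algebra. -/
noncomputable def toEnveloping (c : ℕ) : FreeAlgebra K X →ₐ[K] UFreeNilpotent K X c :=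
  FreeAlgebra.lift K fun y => UniversalEnvelopingAlgebra.ι K (FreeNilpotent.of K c y)

theorem FreeNilpotent.mk_eq_zero {l : FreeLieAlgebra K X}
    (hl : l ∈ LieModule.lowerCentralSeries K (FreeLieAlgebra K X) (FreeLieAlgebra K X) 2) :
    (LieSubmodule.Quotient.mk l : FreeNilpotent K X 2) = 0 :=
  LieSubmodule.Quotient.mk_eq_zero'.2 hl

theorem toEnveloping_eq_zero {f : FreeAlgebra K X} (hf : f ∈ gammaIdeal K X 2) :
    toEnveloping K X 2 f = 0 := by
  refine eq_zero_of_mem_gammaIdeal _ (fun i j k => ?_) hf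
  simp only [toEnveloping, FreeAlgebra.lift_ι_apply, ← LieHom.map_lie]
  have : ⁅FreeNilpotent.of K 2 k, ⁅FreeNilpotent.of K 2 i, FreeNilpotent.of K 2 j⁆⁆ = 0 := by
    simp only [FreeNilpotent.of, ← LieSubmodule.Quotient.mk_bracket]
    refine FreeNilpotent.mk_eq_zero K X ?_
    rw [LieModule.lowerCentralSeries_succ]
    refine LieSubmodule.lie_mem_lie (LieSubmodule.mem_top _) ?_
    rw [LieModule.lowerCentralSeries_succ]
    exact LieSubmodule.lie_mem_lie (LieSubmodule.mem_top _) (by simp)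
  rw [this, map_zero]

/-- The map from the free Lie algebra to the Lie subalgebra generated by the variables. -/
noncomputable def toLieL : FreeLieAlgebra K X →ₗ⁅K⁆ lieL K X :=
  FreeLieAlgebra.lift K fun y => ⟨FreeAlgebra.ι K y, ι_mem_lieL y⟩

/-- The map from the free Lie algebra to the quotient `K⟨X⟩/I`. -/
noncomputable def freeLieToQuotient :
    FreeLieAlgebra K X →ₗ⁅K⁆ (gammaIdeal K X 2).ringCon.Quotient :=
  ((quotientMk (gammaIdeal K X 2)).toLieHom.comp (lieL K X).incl).comp (toLieL K X)

/-- Lie homomorphisms respect lower central series, so `l` goes into `γ₃(L)`, which lies in `I`. -/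
theorem freeLieToQuotient_eq_zero {l : FreeLieAlgebra K X}
    (hl : l ∈ LieModule.lowerCentralSeries K (FreeLieAlgebra K X) (FreeLieAlgebra K X) 2) :
    freeLieToQuotient K X l = 0 := by
  refine quotientMk_eq_zero.2 (TwoSidedIdeal.subset_span ⟨toLieL K X l, ?_, rfl⟩)
  exact LieIdeal.map_lowerCentralSeries_le 2 (LieIdeal.mem_map hl)

theorem freeLieToQuotient_of (y : X) : freeLieToQuotient K X (FreeLieAlgebra.of K y) =
    quotientMk (gammaIdeal K X 2) (FreeAlgebra.ι K y) := by
  simp [freeLieToQuotient, toLieL]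

/-- The map from the free nilpotent Lie algebra to the quotient `K⟨X⟩/I`. -/
noncomputable def nilpotentToQuotient :
    FreeNilpotent K X 2 →ₗ⁅K⁆ (gammaIdeal K X 2).ringCon.Quotient :=
  { Submodule.liftQ _ (freeLieToQuotient K X).toLinearMap
      (fun _ hl => freeLieToQuotient_eq_zero K X hl) with
    map_lie' := by
      rintro ⟨a⟩ ⟨b⟩
      exact (freeLieToQuotient K X).map_lie a b }

theorem nilpotentToQuotient_mk (l : FreeLieAlgebra K X) :
    nilpotentToQuotient K X (LieSubmodule.Quotient.mk l) = freeLieToQuotient K X l := rfl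

/-- The map from the quotient `K⟨X⟩/I` to the enveloping algebra. -/
noncomputable def quotientToEnveloping :
    (gammaIdeal K X 2).ringCon.Quotient →ₐ[K] UFreeNilpotent K X 2 :=
  let ρ : (gammaIdeal K X 2).ringCon.Quotient →+* UFreeNilpotent K X 2 :=
    RingCon.lift _ (toEnveloping K X 2 : FreeAlgebra K X →+* UFreeNilpotent K X 2) fun f g h => by
      have := toEnveloping_eq_zero K X ((TwoSidedIdeal.rel_iff _ _ _).1 h)
      rwa [map_sub, sub_eq_zero] at this
  { ρ with commutes' := fun r => (toEnveloping K X 2).commutes r }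

theorem quotientToEnveloping_mk (f : FreeAlgebra K X) :
    quotientToEnveloping K X (quotientMk _ f) = toEnveloping K X 2 f := rfl

theorem quotientMk_surjective (I : TwoSidedIdeal (FreeAlgebra K X)) :
    Function.Surjective (quotientMk I) := RingCon.mk'_surjective _

theorem lift_comp_quotientToEnveloping :
    (UniversalEnvelopingAlgebra.lift K (nilpotentToQuotient K X)).comp
      (quotientToEnveloping K X) = AlgHom.id K _ := by
  have : ((UniversalEnvelopingAlgebra.lift K (nilpotentToQuotient K X)).comp
      (quotientToEnveloping K X)).comp (quotientMk _) = quotientMk _ := by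
    refine FreeAlgebra.hom_ext (funext fun y => ?_)
    simp [quotientToEnveloping_mk, toEnveloping, FreeNilpotent.of, nilpotentToQuotient_mk,
      freeLieToQuotient_of]
  refine AlgHom.ext fun q => ?_
  obtain ⟨f, rfl⟩ := quotientMk_surjective K X _ q
  exact DFunLike.congr_fun this f

theorem quotientToEnveloping_comp_lift :
    (quotientToEnveloping K X).comp
      (UniversalEnvelopingAlgebra.lift K (nilpotentToQuotient K X)) = AlgHom.id K _ := by
  refine UniversalEnvelopingAlgebra.hom_ext K (LieHom.ext fun q => ?_)
  -- With the projection as a Lie homomorphism, equality can be checked on free generators.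
  let mk : FreeLieAlgebra K X →ₗ⁅K⁆ FreeNilpotent K X 2 :=
    { (LieSubmodule.Quotient.mk' (LieModule.lowerCentralSeries K (FreeLieAlgebra K X)
        (FreeLieAlgebra K X) 2) : _ →ₗ[K] _) with
      map_lie' := fun {a b} => LieSubmodule.Quotient.mk_bracket _ a b }
  have h : ((quotientToEnveloping K X).toLieHom.comp (nilpotentToQuotient K X)).comp mk =
      (UniversalEnvelopingAlgebra.ι K).comp mk := by
    refine FreeLieAlgebra.hom_ext fun y => ?_
    change quotientToEnveloping K X (freeLieToQuotient K X (FreeLieAlgebra.of K y)) = _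
    rw [freeLieToQuotient_of, quotientToEnveloping_mk, toEnveloping, FreeAlgebra.lift_ι_apply]
    rfl
  obtain ⟨l, rfl⟩ := LieSubmodule.Quotient.surjective_mk' _ q
  have := DFunLike.congr_fun h l
  change quotientToEnveloping K X (UniversalEnvelopingAlgebra.lift K (nilpotentToQuotient K X)
    (UniversalEnvelopingAlgebra.ι K (mk l))) = _
  rw [UniversalEnvelopingAlgebra.lift_ι_apply]
  exact this

/-- The isomorphism of `K⟨X⟩/I` with the enveloping algebra. -/
noncomputable def quotientEquivEnveloping :
    (gammaIdeal K X 2).ringCon.Quotient ≃ₐ[K] UFreeNilpotent K X 2 :=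
  AlgEquiv.ofAlgHom (quotientToEnveloping K X)
    (UniversalEnvelopingAlgebra.lift K (nilpotentToQuotient K X))
    (quotientToEnveloping_comp_lift K X) (lift_comp_quotientToEnveloping K X)

theorem quotientEquivEnveloping_mk_ι (y : X) :
    quotientEquivEnveloping K X (quotientMk _ (FreeAlgebra.ι K y)) =
      UniversalEnvelopingAlgebra.ι K (FreeNilpotent.of K 2 y) := by
  change toEnveloping K X 2 (FreeAlgebra.ι K y) = _
  rw [toEnveloping, FreeAlgebra.lift_ι_apply]

end Enveloping

end GroebnerS

theorem theorem3p3 {K : Type*} [Field K] {X : Type*} [LinearOrder X]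
    -- the increasing enumeration `x 1 < x 2 < x 3 < ⋯` of the infinite set `X`
    (x : ℕ+ ≃o X) :
    GroebnerS.IsGroebnerSBasis GroebnerS.WordDegLex (GroebnerS.orderEnd K X)
      (GroebnerS.fiveCommutators
        (FreeAlgebra.ι K (x 1)) (FreeAlgebra.ι K (x 2)) (FreeAlgebra.ι K (x 3)))
      (GroebnerS.gammaIdeal K X 2) ∧
    ∃ e : (GroebnerS.gammaIdeal K X 2).ringCon.Quotient ≃ₐ[K] GroebnerS.UFreeNilpotent K X 2,
      ∀ y : X, e ((FreeAlgebra.ι K y : FreeAlgebra K X) :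
          (GroebnerS.gammaIdeal K X 2).ringCon.Quotient) =
        UniversalEnvelopingAlgebra.ι K (GroebnerS.FreeNilpotent.of K 2 y) :=
  ⟨GroebnerS.isGroebnerSBasis_fiveCommutators x, GroebnerS.quotientEquivEnveloping K X,
    GroebnerS.quotientEquivEnveloping_mk_ι K X⟩
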